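/- **Type II Hamilton–Jacobi theorem for a $\mathbf J$-nonholonomic $R_p$-reduced distributional RCH system.** *System.* Let $Q$ be a smooth $n$-manifold, $\pi_Q:T^*Q\to Q$ its cotangent bundle with canonical one-form $\theta$ and canonical symplectic form $\omega=-\mathbf d\theta$; for a function $f$ let $X_f$ be its Hamiltonian vector field, $\mathbf i_{X_f}\omega=\mathbf df$. A Lie group $G$ acts smoothly, freely and properly from the left on $Q$, and hence on $T^*Q$ by cotangent lifts, with an $\mathrm{Ad}^*$-equivariant momentum map $\mathbf J:T^*Q\to\mathfrak g^*$. Let $L:TQ\to\mathbb R$ be a hyperregular Lagrangian (its Legendre transformation $\mathcal FL:TQ\to T^*Q$ is a diffeomorphism) with Hamiltonian $H(\mathcal FL(v))=\langle\mathcal FL(v),v\rangle-L(v)$, let $\mathcal D\subset TQ$ be a bracket-generating distribution on which the fibre Hessian of $L$ is non-degenerate, let $F:T^*Q\to T^*Q$ be a smooth fibre-preserving map (force), $W\subset T^*Q$ a fibre submanifold (control subset) and $u:T^*Q\to W$ a smooth fibre-preserving control law; $\mathcal D,H,W$ are $G$-invariant and $F$ is $G$-equivariant. For a fibre-preserving map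 $B$ of $T^*Q$ and a vector field $X$ let $\mathrm{vlift}(B)X(\alpha)$ be the vertical part (for a fixed connection on $T^*Q\to Q$) of $TB(X(\alpha))$, translated from $B(\alpha)$ to $\alpha$ along the straight line in the fibre. *Distributional RCH system.* Put $\mathcal M=\mathcal FL(\mathcal D)$, $\mathcal F=(T\pi_Q)^{-1}(\mathcal D)$, $\mathcal K=\mathcal F\cap T\mathcal M$, and assume that the restriction $\omega_{\mathcal K}$ of $\omega$ to $\mathcal K$ is non-degenerate. Let $\tau_{\mathcal K}$ be the $\omega$-orthogonal projection onto $\mathcal K$, let $X_{\mathcal K}$ be the $\mathcal K$-valued vector field on $\mathcal M$ with $\mathbf i_{X_{\mathcal K}}\omega_{\mathcal K}=\mathbf dH|_{\mathcal K}$, and $$\tilde X=X_{\mathcal K}+\tau_{\mathcal K}\,\mathrm{vlift}(F)X_H+\tau_{\mathcal K}\,\mathrm{vlift}(u)X_H .$$ *Reduction.* Let $\mu\in\mathfrak g^*$ be a regular value of $\mathbf J$ with $F(\mathbf J^{-1}(\mu))\subset\mathbf J^{-1}(\mu)$ and $W\cap\mathbf J^{-1}(\mu)\ne\emptyset$, and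 let $G_\mu$ be its coadjoint isotropy group. Let $i_\mu:\mathbf J^{-1}(\mu)\to T^*Q$ be the inclusion, $\pi_\mu:\mathbf J^{-1}(\mu)\to(T^*Q)_\mu=\mathbf J^{-1}(\mu)/G_\mu$ the projection, $\omega_\mu$ the reduced symplectic form, $\pi_\mu^*\omega_\mu=i_\mu^*\omega$, and $h_\mu$ the reduced Hamiltonian, $h_\mu\circ\pi_\mu=H\circ i_\mu$. Assume that $\mathcal M\cap\mathbf J^{-1}(\mu)$ is non-empty and the intersection is clean. Put $\mathcal M_\mu=\pi_\mu(\mathcal M\cap\mathbf J^{-1}(\mu))$, $\mathcal F_\mu=T\pi_\mu(\mathcal F\cap T\mathbf J^{-1}(\mu))$ along $\mathcal M_\mu$, and $\mathcal K_\mu=\mathcal F_\mu\cap T\mathcal M_\mu$. Assume that the restriction $\omega_{\mathcal K_\mu}$ of $\omega_\mu$ to $\mathcal K_\mu$ is non-degenerate; let $\tau_{\mathcal K_\mu}$ be the $\omega_\mu$-orthogonal projection onto $\mathcal K_\mu$ and $X_{\mathcal K_\mu}$ the $\mathcal K_\mu$-valued vector field on $\mathcal M_\mu$ with $\mathbf i_{X_{\mathcal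 K_\mu}}\omega_{\mathcal K_\mu}=\mathbf dh_\mu|_{\mathcal K_\mu}$. Write $h_{\mathcal K_\mu}$ for $h_\mu$ restricted to $\mathcal M_\mu$. *Data.* Let $\gamma:Q\to T^*Q$ be a smooth one-form that is $G_\mu$-invariant ($\gamma(gq)=g\cdot\gamma(q)$), with $\mathrm{Im}\,\gamma\subset\mathcal M\cap\mathbf J^{-1}(\mu)$, and let $\lambda=\gamma\circ\pi_Q$, $\bar\gamma_\mu=\pi_\mu\circ\gamma$, $\bar\lambda_\mu=\pi_\mu\circ\lambda$; assume $\mathrm{Im}(T\bar\gamma_\mu)\subset\mathcal K_\mu$. Let $\varepsilon:T^*Q\to T^*Q$ be a symplectic map that is $G_\mu$-invariant ($\varepsilon(gz)=g\cdot\varepsilon(z)$) with $\varepsilon(\mathcal M\cap\mathbf J^{-1}(\mu))\subset\mathcal M\cap\mathbf J^{-1}(\mu)$; let $\bar\varepsilon_\mu=\pi_\mu\circ\varepsilon:\mathcal M\cap\mathbf J^{-1}(\mu)\to\mathcal M_\mu$ and $\tilde X^{\varepsilon}=T\pi_Q\cdot\tilde X\cdot\varepsilon$. Let $X_{h_{\mathcal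 K_\mu}\circ\bar\varepsilon_\mu}$ be the Hamiltonian vector field on $T^*Q$ of $h_{\mathcal K_\mu}\circ\bar\varepsilon_\mu$, regarded as the function $H\circ\varepsilon:T^*Q\to\mathbb R$, and $T\bar\varepsilon_\mu=T\pi_\mu\cdot T\varepsilon$. *Claim.* The equation $$\tau_{\mathcal K_\mu}\cdot T\bar\varepsilon_\mu\bigl(X_{h_{\mathcal K_\mu}\circ\bar\varepsilon_\mu}\bigr)=T\bar\lambda_\mu\cdot\tilde X\cdot\varepsilon$$ holds on $\mathcal M\cap\mathbf J^{-1}(\mu)$ if and only if the equation $$T\bar\gamma_\mu\cdot\tilde X^{\varepsilon}=X_{\mathcal K_\mu}\cdot\bar\varepsilon_\mu$$ holds on $\mathcal M\cap\mathbf J^{-1}(\mu)$. Both are equations between vectors of $T(T^*Q)_\mu$, base points included. -/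

import Mathlib

open scoped Manifold ContDiff Topology
open Bundle Manifold

noncomputable section

namespace RCH

/-! ### Generalities on smooth manifolds -/

section General

variable {E : Type*} [NormedAddCommGroup E] [NormedSpace ℝ E]
  {H : Type*} [TopologicalSpace H] (I : ModelWithCorners ℝ E H)
  {N : Type*} [TopologicalSpace N] [ChartedSpace H N]

/-- `S` is an embedded submanifold: with the subspace topology it carries a smooth structure for
which the inclusion is a smooth embedding. -/
def IsEmbeddedSubmanifold (S : Set N) : Prop :=
  ∃ (k : ℕ) (_ : ChartedSpace (EuclideanSpace ℝ (Fin k)) S),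
    IsManifold (𝓡 k) ∞ S ∧ IsSmoothEmbedding (𝓡 k) I ∞ (Subtype.val : S → N)

/-- The tangent space `T_x S` of a submanifold `S`, as a subspace of the ambient tangent space:
the velocities at `x` of smooth curves that run in `S`. (For a submanifold these velocities already
form a linear subspace.) -/
def tangentOf (S : Set N) (x : N) : Submodule ℝ (TangentSpace I x) :=
  Submodule.span ℝ {v | ∃ c : ℝ → N, ContMDiffAt 𝓘(ℝ, ℝ) I ∞ c 0 ∧ (∀ᶠ t in 𝓝 0, c t ∈ S) ∧
    (⟨c 0, mfderiv 𝓘(ℝ, ℝ) I c 0 (1 : ℝ)⟩ : TangentBundle I N) = ⟨x, v⟩}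

/-- The exterior derivative `dθ` of a one-form `θ`, as a bilinear form on each tangent space,
computed in the preferred chart at the point (in which Mathlib's tangent space is the model
space): `dθ(v, w) = D_v θ(w) - D_w θ(v)`. -/
def extDerivOneForm (θ : ∀ x : N, TangentSpace I x →L[ℝ] ℝ) (x : N) :
    TangentSpace I x →L[ℝ] TangentSpace I x →L[ℝ] ℝ :=
  let θ' : E → E →L[ℝ] ℝ := fun y =>
    (θ ((extChartAt I x).symm y)).comp (mfderiv 𝓘(ℝ, E) I (extChartAt I x).symm y)
  let A : E →L[ℝ] E →L[ℝ] ℝ := fderiv ℝ θ' (extChartAt I x x)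
  (A - A.flip : E →L[ℝ] E →L[ℝ] ℝ)

end General

/-- For a bilinear form `B` that is non-degenerate on the subspace `K` of `V`, the unique `k ∈ K`
with `B(k, w) = α(w)` for all `w ∈ K`. -/
def represent {V : Type*} [AddCommGroup V] [Module ℝ V] (K : Submodule ℝ V) (B : V → V → ℝ)
    (α : V → ℝ) : V :=
  Classical.epsilon fun k => k ∈ K ∧ ∀ w ∈ K, B k w = α w

/-- The restriction of the form `B` to the subspace `K` is non-degenerate. -/
def NondegenerateOn {V : Type*} [AddCommGroup V] [Module ℝ V] (K : Submodule ℝ V)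
    (B : V → V → ℝ) : Prop :=
  ∀ v ∈ K, (∀ w ∈ K, B v w = 0) → v = 0

/-- The restriction map `τ_K` to `K`: the projection of `V` onto `K` along the `B`-orthogonal
of `K`, that is, `τ_K v ∈ K` and `B(τ_K v, w) = B(v, w)` for all `w ∈ K`. -/
def restrictTo {V : Type*} [AddCommGroup V] [Module ℝ V] (K : Submodule ℝ V) (B : V → V → ℝ)
    (v : V) : V :=
  represent K B (B v)

/-! ### The cotangent bundle and its canonical symplectic form -/

section Cotangent

variable (E : Type*) [NormedAddCommGroup E] [NormedSpace ℝ E]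
  (Q : Type*) [TopologicalSpace Q] [ChartedSpace E Q]

/-- The cotangent space `T_q^* Q`. -/
abbrev Cov (q : Q) : Type _ := TangentSpace 𝓘(ℝ, E) q →L[ℝ] ℝ

/-- The cotangent bundle `T^* Q`. -/
abbrev CotBundle : Type _ := TotalSpace (E →L[ℝ] ℝ) (Cov E Q)

/-- The model with corners of `T^* Q`. -/
abbrev IT : ModelWithCorners ℝ (E × (E →L[ℝ] ℝ)) (ModelProd E (E →L[ℝ] ℝ)) :=
  𝓘(ℝ, E).prod 𝓘(ℝ, E →L[ℝ] ℝ)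


variable {E Q}

/-- The tangent map `T_z π_Q` of the projection `π_Q : T^* Q → Q`. -/
def dProj [IsManifold 𝓘(ℝ, E) 1 Q] (z : CotBundle E Q) :
    TangentSpace (IT E) z →L[ℝ] TangentSpace 𝓘(ℝ, E) z.proj :=
  mfderiv (IT E) 𝓘(ℝ, E) (fun y : CotBundle E Q => y.proj) z

/-- The canonical one-form `θ` on `T^* Q`: `θ_α(v) = α(Tπ_Q v)`. -/
def canonicalOneForm [IsManifold 𝓘(ℝ, E) 1 Q] (z : CotBundle E Q) :
    TangentSpace (IT E) z →L[ℝ] ℝ :=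
  z.2.comp (dProj z)

/-- The canonical symplectic form `ω = -dθ` on `T^* Q`. -/
def canonicalForm [IsManifold 𝓘(ℝ, E) 1 Q] (z : CotBundle E Q) :
    TangentSpace (IT E) z →L[ℝ] TangentSpace (IT E) z →L[ℝ] ℝ :=
  -extDerivOneForm (IT E) canonicalOneForm z

/-- The differential of a function on `T^* Q`. -/
def dFun [IsManifold 𝓘(ℝ, E) 1 Q] (f : CotBundle E Q → ℝ) (z : CotBundle E Q) :
    TangentSpace (IT E) z →L[ℝ] ℝ :=
  mfderiv (IT E) 𝓘(ℝ, ℝ) f z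

/-- The Hamiltonian vector field `X_f` on `(T^* Q, ω)`: the vector field with
`i_{X_f} ω = df`. -/
def hamiltonianVectorField [IsManifold 𝓘(ℝ, E) 1 Q] (f : CotBundle E Q → ℝ)
    (z : CotBundle E Q) : TangentSpace (IT E) z :=
  represent ⊤ (fun v w => canonicalForm z v w) (dFun f z)

/-- A symplectic map `ε : T^* Q → T^* Q`: smooth, with `ε^* ω = ω`. -/
def IsSymplecticMap [IsManifold 𝓘(ℝ, E) 1 Q] (ε : CotBundle E Q → CotBundle E Q) : Prop :=
  ContMDiff (IT E) (IT E) ∞ ε ∧ ∀ z v w,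
    canonicalForm (ε z) (mfderiv (IT E) (IT E) ε z v) (mfderiv (IT E) (IT E) ε z w) =
      canonicalForm z v w

/-- The map `T^* Q → T^* Q` given by a family of maps of the fibres. Every fibre-preserving
(over the identity of `Q`) map is of this form. -/
def fiberMap (F : ∀ q : Q, Cov E Q q → Cov E Q q) (z : CotBundle E Q) : CotBundle E Q :=
  ⟨z.proj, F z.proj z.2⟩

/-- A one-form `γ` on `Q` as a map `Q → T^* Q`. -/
def toMap (γ : ∀ q : Q, Cov E Q q) (q : Q) : CotBundle E Q := ⟨q, γ q⟩

/-- The vertical vector at `z = (q, α)` with fibre component `β ∈ T_q^* Q`: the velocity at `t = 0`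
of the straight line `α + t β`. -/
def verticalLift [IsManifold 𝓘(ℝ, E) 1 Q] (z : CotBundle E Q) (β : Cov E Q z.proj) :
    TangentSpace (IT E) z :=
  (mfderiv 𝓘(ℝ, ℝ) (IT E) (fun t : ℝ => (⟨z.proj, z.2 + t • β⟩ : CotBundle E Q)) 0 (1 : ℝ) :
    E × (E →L[ℝ] ℝ))

variable (E Q) in
/-- A smooth (Ehresmann) connection on `T^* Q → Q`, that is, a smooth splitting
`T(T^* Q) = horizontal ⊕ vertical`. It is recorded by its vertical part
`T_z(T^* Q) → V_z ≅ T_q^* Q`, which inverts the vertical lift. -/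
structure VerticalConnection [IsManifold 𝓘(ℝ, E) ∞ Q] where
  /-- the vertical part of a tangent vector, as an element of the fibre -/
  vert : ∀ z : CotBundle E Q, TangentSpace (IT E) z →L[ℝ] Cov E Q z.proj
  vert_verticalLift : ∀ z β, vert z (verticalLift z β) = β
  smooth : ContMDiff (IT E).tangent (IT E) ∞
    (fun x : TangentBundle (IT E) (CotBundle E Q) =>
      (⟨x.proj.proj, vert x.proj x.2⟩ : CotBundle E Q))

/-- The change `vlift(F) X` of the vector field `X` under the action of the fibre-preserving map
`F`: at `α`, the vertical part of `TF (X(α)) ∈ T_{F(α)}(T^* Q)`, displaced parallelly to `α` along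
the straight line of the fibre that joins `F(α)` and `α`. -/
def vlift [IsManifold 𝓘(ℝ, E) ∞ Q] (A : VerticalConnection E Q)
    (F : ∀ q : Q, Cov E Q q → Cov E Q q)
    (X : ∀ z : CotBundle E Q, TangentSpace (IT E) z) (z : CotBundle E Q) :
    TangentSpace (IT E) z :=
  verticalLift z (A.vert (fiberMap F z) (mfderiv (IT E) (IT E) (fiberMap F) z (X z)))

/-! ### Lagrangians and nonholonomic constraints -/

/-- The fibre derivative `d/dt L(v + t w)` of `L : TQ → ℝ`, as the Legendre transformation
`FL : TQ → T^* Q`. -/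
def legendre (L : TangentBundle 𝓘(ℝ, E) Q → ℝ) (v : TangentBundle 𝓘(ℝ, E) Q) : CotBundle E Q :=
  ⟨v.proj, fderiv ℝ (fun w : TangentSpace 𝓘(ℝ, E) v.proj => L ⟨v.proj, w⟩) v.2⟩

/-- The fibre Hessian of `L` at `v`. -/
def fiberHessian (L : TangentBundle 𝓘(ℝ, E) Q → ℝ) (v : TangentBundle 𝓘(ℝ, E) Q) :
    TangentSpace 𝓘(ℝ, E) v.proj →L[ℝ] Cov E Q v.proj :=
  fderiv ℝ (fun w : TangentSpace 𝓘(ℝ, E) v.proj => (legendre L ⟨v.proj, w⟩).2) v.2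

/-- `L` is hyperregular: the Legendre transformation is a diffeomorphism (so that, in particular,
the fibre Hessian of `L` is non-degenerate everywhere). -/
def Hyperregular [IsManifold 𝓘(ℝ, E) ∞ Q] (L : TangentBundle 𝓘(ℝ, E) Q → ℝ) : Prop :=
  ∃ Φ : Diffeomorph 𝓘(ℝ, E).tangent (IT E) (TangentBundle 𝓘(ℝ, E) Q) (CotBundle E Q) ∞,
    ∀ v, Φ v = legendre L v

/-- A vector field on `Q`, smooth on the set `U`. -/
def SmoothFieldOn [IsManifold 𝓘(ℝ, E) 1 Q] (X : ∀ q : Q, TangentSpace 𝓘(ℝ, E) q) (U : Set Q) :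
    Prop :=
  ContMDiffOn 𝓘(ℝ, E) 𝓘(ℝ, E).tangent ∞ (fun q => (⟨q, X q⟩ : TangentBundle 𝓘(ℝ, E) Q)) U

/-- `D` is a smooth distribution of constant rank: locally it has a smooth frame. -/
def IsDistribution [IsManifold 𝓘(ℝ, E) 1 Q] (D : ∀ q : Q, Submodule ℝ (TangentSpace 𝓘(ℝ, E) q)) :
    Prop :=
  ∃ k : ℕ, ∀ q₀ : Q, ∃ U : Set Q, IsOpen U ∧ q₀ ∈ U ∧
    ∃ X : Fin k → ∀ q : Q, TangentSpace 𝓘(ℝ, E) q, (∀ i, SmoothFieldOn (X i) U) ∧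
      ∀ q ∈ U, LinearIndependent ℝ (fun i => X i q) ∧
        D q = Submodule.span ℝ (Set.range fun i => X i q)

/-- The smooth sections of `D` and their iterated Lie brackets
`[D, D]`, `[D, [D, D]]`, … -/
inductive IteratedBracket [IsManifold 𝓘(ℝ, E) 1 Q]
    (D : ∀ q : Q, Submodule ℝ (TangentSpace 𝓘(ℝ, E) q)) :
    (∀ q : Q, TangentSpace 𝓘(ℝ, E) q) → Prop
  | base (X : ∀ q : Q, TangentSpace 𝓘(ℝ, E) q) (hX : SmoothFieldOn X Set.univ)
      (hD : ∀ q, X q ∈ D q) : IteratedBracket D X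
  | bracket (X Y : ∀ q : Q, TangentSpace 𝓘(ℝ, E) q) (hX : SmoothFieldOn X Set.univ)
      (hD : ∀ q, X q ∈ D q) (hY : IteratedBracket D Y) :
      IteratedBracket D (VectorField.mlieBracket 𝓘(ℝ, E) X Y)

/-- `D` is completely nonholonomic (bracket-generating): its sections and their iterated brackets
span `TQ`. -/
def CompletelyNonholonomic [IsManifold 𝓘(ℝ, E) 1 Q]
    (D : ∀ q : Q, Submodule ℝ (TangentSpace 𝓘(ℝ, E) q)) : Prop :=
  ∀ q, Submodule.span ℝ {v | ∃ X, IteratedBracket D X ∧ X q = v} = ⊤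

/-- `L` is `D`-regular: the restriction of its fibre Hessian to `D` is non-degenerate along `D`. -/
def RegularOn (L : TangentBundle 𝓘(ℝ, E) Q → ℝ)
    (D : ∀ q : Q, Submodule ℝ (TangentSpace 𝓘(ℝ, E) q)) : Prop :=
  ∀ (q : Q), ∀ v ∈ D q, NondegenerateOn (D q) fun a b => fiberHessian L ⟨q, v⟩ a b

/-! ### Lie group actions -/

variable (EG : Type*) [NormedAddCommGroup EG] [NormedSpace ℝ EG]
  {G : Type*} [TopologicalSpace G] [ChartedSpace EG G] [Group G]

/-- The tangent lift `T_q Φ_g : T_q Q → T_{gq} Q` of the action of `g`. -/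
def tangentLift [MulAction G Q] (g : G) (q : Q) :
    TangentSpace 𝓘(ℝ, E) q →L[ℝ] TangentSpace 𝓘(ℝ, E) (g • q) :=
  mfderiv 𝓘(ℝ, E) 𝓘(ℝ, E) (fun y : Q => g • y) q

/-- The cotangent lifted left action of `g` on `T^* Q`: `(q, α) ↦ (g q, α ∘ (T_q Φ_g)⁻¹)`. -/
def cotLift [MulAction G Q] (g : G) (z : CotBundle E Q) : CotBundle E Q :=
  ⟨g • z.proj, z.2.comp (tangentLift g z.proj).inverse⟩

/-- The infinitesimal generator of `ξ ∈ 𝔤` on `T^* Q`: the derivative of `g ↦ g z` at `1` in the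
direction `ξ`. -/
def generator [IsManifold 𝓘(ℝ, E) 1 Q] [MulAction G Q]
    (ξ : GroupLieAlgebra 𝓘(ℝ, EG) G) (z : CotBundle E Q) : TangentSpace (IT E) z :=
  (mfderiv 𝓘(ℝ, EG) (IT E) (fun g : G => cotLift g z) 1 ξ : E × (E →L[ℝ] ℝ))

/-- The adjoint action `Ad_g` on the Lie algebra: the derivative at `1` of `h ↦ g h g⁻¹`. -/
def adjointAction (g : G) (ξ : GroupLieAlgebra 𝓘(ℝ, EG) G) : GroupLieAlgebra 𝓘(ℝ, EG) G :=
  (mfderiv 𝓘(ℝ, EG) 𝓘(ℝ, EG) (fun h : G => g * h * g⁻¹) 1 ξ : EG)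

/-- `J : T^* Q → 𝔤^*` is an `Ad^*`-equivariant momentum map of the cotangent lifted action:
`d⟨J, ξ⟩ = i_{ξ_{T^*Q}} ω` and `⟨J(g z), Ad_g ξ⟩ = ⟨J(z), ξ⟩`. -/
def IsMomentumMap [IsManifold 𝓘(ℝ, E) 1 Q] [MulAction G Q]
    (J : CotBundle E Q → EG →L[ℝ] ℝ) : Prop :=
  ContMDiff (IT E) 𝓘(ℝ, EG →L[ℝ] ℝ) ∞ J ∧
  (∀ (ξ : GroupLieAlgebra 𝓘(ℝ, EG) G) (z : CotBundle E Q) (v : TangentSpace (IT E) z),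
    dFun (fun y => J y ξ) z v = canonicalForm z (generator EG ξ z) v) ∧
  ∀ (g : G) (ξ : GroupLieAlgebra 𝓘(ℝ, EG) G) (z : CotBundle E Q),
    J (cotLift g z) (adjointAction EG g ξ) = J z ξ

end Cotangent

/-! ### Nonholonomic RCH systems with symmetry and momentum map -/

section System

variable (E : Type*) [NormedAddCommGroup E] [NormedSpace ℝ E]
  (Q : Type*) [TopologicalSpace Q] [ChartedSpace E Q] [IsManifold 𝓘(ℝ, E) ∞ Q]
  (EG : Type*) [NormedAddCommGroup EG] [NormedSpace ℝ EG]
  (G : Type*) [TopologicalSpace G] [ChartedSpace EG G] [Group G] [MulAction G Q]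

/-- A nonholonomic RCH system `(T^* Q, G, ω, J, D, H, F, W)` with symmetry and momentum map, where
`ω` is the canonical symplectic form, together with the Lagrangian `L` that defines `H` and the
constraint submanifold. -/
structure NonholonomicSystem where
  /-- the Lagrangian -/
  L : TangentBundle 𝓘(ℝ, E) Q → ℝ
  /-- the nonholonomic constraint -/
  D : ∀ q : Q, Submodule ℝ (TangentSpace 𝓘(ℝ, E) q)
  /-- the Hamiltonian -/
  H : CotBundle E Q → ℝ
  /-- the (fibre-preserving) external force map -/
  F : ∀ q : Q, Cov E Q q → Cov E Q q
  /-- the control subset -/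
  W : Set (CotBundle E Q)
  /-- the momentum map -/
  J : CotBundle E Q → EG →L[ℝ] ℝ
  action_smooth : ContMDiff (𝓘(ℝ, EG).prod 𝓘(ℝ, E)) 𝓘(ℝ, E) ∞ fun p : G × Q => p.1 • p.2
  action_free : ∀ (g : G) (q : Q), g • q = q → g = 1
  action_proper : ProperSMul G Q
  L_smooth : ContMDiff 𝓘(ℝ, E).tangent 𝓘(ℝ, ℝ) ∞ L
  L_hyperregular : Hyperregular L
  D_distribution : IsDistribution D
  D_complete : CompletelyNonholonomic D
  D_regular : RegularOn L D
  D_invariant : ∀ (g : G) (q : Q), ∀ v ∈ D q, tangentLift g q v ∈ D (g • q)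
  H_smooth : ContMDiff (IT E) 𝓘(ℝ, ℝ) ∞ H
  H_legendre : ∀ v : TangentBundle 𝓘(ℝ, E) Q, H (legendre L v) = (legendre L v).2 v.2 - L v
  H_invariant : ∀ (g : G) (z : CotBundle E Q), H (cotLift g z) = H z
  F_smooth : ContMDiff (IT E) (IT E) ∞ (fiberMap F)
  F_invariant : ∀ (g : G) (z : CotBundle E Q), fiberMap F (cotLift g z) = cotLift g (fiberMap F z)
  /-- `W` is a fibre submanifold of `T^* Q` -/
  W_submanifold : IsEmbeddedSubmanifold (IT E) W ∧
    ∀ q : Q, IsEmbeddedSubmanifold 𝓘(ℝ, E →L[ℝ] ℝ) {α : E →L[ℝ] ℝ | (⟨q, α⟩ : CotBundle E Q) ∈ W}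
  W_invariant : ∀ (g : G), ∀ z ∈ W, cotLift g z ∈ W
  J_momentum : IsMomentumMap (G := G) EG J

variable {E Q EG G}

namespace NonholonomicSystem

variable (S : NonholonomicSystem E Q EG G)

/-- A control law `u ∈ W`: a smooth fibre-preserving map `T^* Q → W`. -/
def IsControlLaw (u : ∀ q : Q, Cov E Q q → Cov E Q q) : Prop :=
  ContMDiff (IT E) (IT E) ∞ (fiberMap u) ∧ ∀ z, fiberMap u z ∈ S.W

/-- The constraint submanifold `M = FL(D) ⊂ T^* Q`. -/
def M : Set (CotBundle E Q) := legendre S.L '' {v | v.2 ∈ S.D v.proj}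

/-- The distribution `𝓕 = (Tπ_Q)⁻¹(D)`. -/
def distF (z : CotBundle E Q) : Submodule ℝ (TangentSpace (IT E) z) :=
  (S.D z.proj).comap (dProj z).toLinearMap

/-- The distribution `𝓚 = 𝓕 ∩ TM` along `M`. -/
def distK (z : CotBundle E Q) : Submodule ℝ (TangentSpace (IT E) z) :=
  S.distF z ⊓ tangentOf (IT E) S.M z

/-- The restriction map `τ_𝓚` of tangent vectors to `𝓚`. -/
def tauK (z : CotBundle E Q) (v : TangentSpace (IT E) z) : TangentSpace (IT E) z :=
  restrictTo (S.distK z) (fun a b => canonicalForm z a b) v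

/-- The nonholonomic dynamical vector field `X_𝓚`: the vector field on `M` with values in `𝓚` and
`i_{X_𝓚} ω_𝓚 = dH_𝓚`, where `ω_𝓚` and `dH_𝓚` are the restrictions of `ω` and `dH` to `𝓚`. -/
def fieldK (z : CotBundle E Q) : TangentSpace (IT E) z :=
  represent (S.distK z) (fun a b => canonicalForm z a b) (dFun S.H z)

/-- The dynamical vector field `X̃ = X_𝓚 + F_𝓚 + u_𝓚` of the distributional RCH system, where
`F_𝓚 = τ_𝓚 vlift(F) X_H` and `u_𝓚 = τ_𝓚 vlift(u) X_H`. -/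
def dynamicalField (A : VerticalConnection E Q) (u : ∀ q : Q, Cov E Q q → Cov E Q q)
    (z : CotBundle E Q) : TangentSpace (IT E) z :=
  S.fieldK z + S.tauK z (vlift A S.F (hamiltonianVectorField S.H) z) +
    S.tauK z (vlift A u (hamiltonianVectorField S.H) z)

/-! #### Regular point reduction -/

variable (G) in
/-- The isotropy subgroup `G_μ = {g | Ad_g^* μ = μ}`. -/
def isotropy (μ : EG →L[ℝ] ℝ) : Set G :=
  {g | ∀ ξ : GroupLieAlgebra 𝓘(ℝ, EG) G, μ (adjointAction EG g ξ) = μ ξ}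

/-- The level set `J⁻¹(μ)`. -/
abbrev Level (μ : EG →L[ℝ] ℝ) : Type _ := {z : CotBundle E Q // S.J z = μ}

/-- The reduced space `(T^* Q)_μ = J⁻¹(μ) / G_μ`, with the quotient topology. -/
abbrev Reduced (μ : EG →L[ℝ] ℝ) : Type _ :=
  Quot fun z z' : S.Level μ => ∃ g ∈ isotropy G μ, cotLift g z.1 = z'.1

/-- The inclusion `i_μ : J⁻¹(μ) → T^* Q`. -/
def incl (μ : EG →L[ℝ] ℝ) (z : S.Level μ) : CotBundle E Q := z.1

/-- The projection `π_μ : J⁻¹(μ) → (T^* Q)_μ`. -/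
def proj (μ : EG →L[ℝ] ℝ) (z : S.Level μ) : S.Reduced μ := Quot.mk _ z

/-- The reduced Hamiltonian `h_μ`, given by `h_μ ∘ π_μ = H ∘ i_μ`. -/
def reducedHamiltonian (μ : EG →L[ℝ] ℝ) : S.Reduced μ → ℝ :=
  Quot.lift (fun z => S.H z.1) fun z z' h => by
    obtain ⟨g, -, hg⟩ := h
    rw [← hg, S.H_invariant]

/-- The reduced constraint submanifold `M_μ = (M ∩ J⁻¹(μ)) / G_μ`. -/
def reducedM (μ : EG →L[ℝ] ℝ) : Set (S.Reduced μ) := S.proj μ '' {z | z.1 ∈ S.M}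

section Reduction

variable {μ : EG →L[ℝ] ℝ}
  (EP : Type*) [NormedAddCommGroup EP] [NormedSpace ℝ EP] [ChartedSpace EP (S.Level μ)]
  (EN : Type*) [NormedAddCommGroup EN] [NormedSpace ℝ EN] [ChartedSpace EN (S.Reduced μ)]

/-- The tangent map `T i_μ`. -/
def dIncl (z : S.Level μ) : TangentSpace 𝓘(ℝ, EP) z →L[ℝ] TangentSpace (IT E) z.1 :=
  mfderiv 𝓘(ℝ, EP) (IT E) (S.incl μ) z

/-- The tangent map `T π_μ`. -/
def dRed (z : S.Level μ) :
    TangentSpace 𝓘(ℝ, EP) z →L[ℝ] TangentSpace 𝓘(ℝ, EN) (S.proj μ z) :=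
  mfderiv 𝓘(ℝ, EP) 𝓘(ℝ, EN) (S.proj μ) z

/-- The tangent map `T π_μ` on those vectors of `T_z(T^* Q)` that are tangent to `J⁻¹(μ)`
(`T i_μ` is injective). -/
def dRedAmbient (z : S.Level μ) (v : TangentSpace (IT E) z.1) :
    TangentSpace 𝓘(ℝ, EN) (S.proj μ z) :=
  S.dRed EP EN z (Classical.epsilon fun v' => S.dIncl EP z v' = v)

/-- The smooth structures of `J⁻¹(μ)` and of `(T^* Q)_μ` are the standard ones, and `ω_μ` is the
reduced symplectic form: `J⁻¹(μ)` is an embedded submanifold of `T^* Q`, `π_μ` is a submersion, and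
`π_μ^* ω_μ = i_μ^* ω`. (These conditions determine both smooth structures and `ω_μ`.) -/
structure IsReduction
    (ωμ : ∀ p : S.Reduced μ, TangentSpace 𝓘(ℝ, EN) p →L[ℝ] TangentSpace 𝓘(ℝ, EN) p →L[ℝ] ℝ) :
    Prop where
  incl_embedding : IsSmoothEmbedding 𝓘(ℝ, EP) (IT E) ∞ (S.incl μ)
  proj_submersion : IsSubmersion 𝓘(ℝ, EP) 𝓘(ℝ, EN) ∞ (S.proj μ)
  pullback_form : ∀ (z : S.Level μ) (v w : TangentSpace 𝓘(ℝ, EP) z),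
    ωμ (S.proj μ z) (S.dRed EP EN z v) (S.dRed EP EN z w) =
      canonicalForm z.1 (S.dIncl EP z v) (S.dIncl EP z w)

/-- The distribution `𝓕_μ = Tπ_μ · 𝓕` along `M_μ`. (By invariance the vectors obtained from one
point of the fibre `π_μ⁻¹(p)` already form this subspace.) -/
def reducedF (p : S.Reduced μ) : Submodule ℝ (TangentSpace 𝓘(ℝ, EN) p) :=
  Submodule.span ℝ {n | ∃ z : S.Level μ, z.1 ∈ S.M ∧
    ∃ v : TangentSpace 𝓘(ℝ, EP) z, S.dIncl EP z v ∈ S.distF z.1 ∧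
      (⟨S.proj μ z, S.dRed EP EN z v⟩ : TangentBundle 𝓘(ℝ, EN) (S.Reduced μ)) = ⟨p, n⟩}

/-- The distribution `𝓚_μ = 𝓕_μ ∩ TM_μ` along `M_μ`. -/
def reducedK (p : S.Reduced μ) : Submodule ℝ (TangentSpace 𝓘(ℝ, EN) p) :=
  S.reducedF EP EN p ⊓ tangentOf 𝓘(ℝ, EN) (S.reducedM μ) p

variable (ωμ : ∀ p : S.Reduced μ,
  TangentSpace 𝓘(ℝ, EN) p →L[ℝ] TangentSpace 𝓘(ℝ, EN) p →L[ℝ] ℝ)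

/-- The restriction map `τ_{𝓚_μ}` of tangent vectors to `𝓚_μ`. -/
def reducedTau (p : S.Reduced μ) (n : TangentSpace 𝓘(ℝ, EN) p) : TangentSpace 𝓘(ℝ, EN) p :=
  restrictTo (S.reducedK EP EN p) (fun a b => ωμ p a b) n

/-- The reduced dynamical vector field `X_{𝓚_μ}`: the vector field on `M_μ` with values in `𝓚_μ`
and `i_{X_{𝓚_μ}} ω_{𝓚_μ} = dh_{𝓚_μ}`, where `ω_{𝓚_μ}` and `dh_{𝓚_μ}` are the restrictions of `ω_μ`
and `dh_μ` to `𝓚_μ`. -/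
def reducedField (p : S.Reduced μ) : TangentSpace 𝓘(ℝ, EN) p :=
  represent (S.reducedK EP EN p) (fun a b => ωμ p a b)
    (mfderiv 𝓘(ℝ, EN) 𝓘(ℝ, ℝ) (S.reducedHamiltonian μ) p)

/-- `(T^* Q, G, ω, J, D, H, F, u)` is a `J`-nonholonomic regular point reducible RCH system at `μ`,
with an associated distributional RCH system and a `J`-nonholonomic `R_p`-reduced distributional
RCH system. -/
structure IsPointReducible (u : ∀ q : Q, Cov E Q q → Cov E Q q) : Prop where
  control_law : S.IsControlLaw u
  /-- `μ` is a regular value of `J` -/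
  regular_value : ∀ z : CotBundle E Q, S.J z = μ →
    Function.Surjective (mfderiv (IT E) 𝓘(ℝ, EG →L[ℝ] ℝ) S.J z)
  force_level : ∀ z : CotBundle E Q, S.J z = μ → S.J (fiberMap S.F z) = μ
  control_level : (S.W ∩ S.J ⁻¹' {μ}).Nonempty
  /-- `M` and `J⁻¹(μ)` meet, and their intersection is clean -/
  meets_level : (S.M ∩ S.J ⁻¹' {μ}).Nonempty
  clean_submanifold : IsEmbeddedSubmanifold (IT E) (S.M ∩ S.J ⁻¹' {μ})
  clean_tangent : ∀ z ∈ S.M ∩ S.J ⁻¹' {μ}, tangentOf (IT E) (S.M ∩ S.J ⁻¹' {μ}) z =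
    tangentOf (IT E) S.M z ⊓ tangentOf (IT E) (S.J ⁻¹' {μ}) z
  reduction : S.IsReduction EP EN ωμ
  /-- `ω_𝓚` is non-degenerate -/
  nondegenerate : ∀ z ∈ S.M, NondegenerateOn (S.distK z) fun a b => canonicalForm z a b
  /-- `ω_{𝓚_μ}` is non-degenerate -/
  reduced_nondegenerate : ∀ p ∈ S.reducedM μ,
    NondegenerateOn (S.reducedK EP EN p) fun a b => ωμ p a b

end Reduction

/-- `ε̄_μ = π_μ ∘ ε : M ∩ J⁻¹(μ) → (T^* Q)_μ`, for a map `ε` that preserves `M ∩ J⁻¹(μ)`. Its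
values lie in `M_μ`. -/
def epsBar {μ : EG →L[ℝ] ℝ} (ε : CotBundle E Q → CotBundle E Q)
    (hε : ∀ z ∈ S.M ∩ S.J ⁻¹' {μ}, ε z ∈ S.M ∩ S.J ⁻¹' {μ})
    (z : ↥(S.M ∩ S.J ⁻¹' {μ})) : S.Reduced μ :=
  S.proj μ ⟨ε z, (hε z z.2).2⟩

/-- The function `h_{𝓚_μ} ∘ ε̄_μ` as a function on `T^* Q`: because of `h_μ ∘ π_μ = H ∘ i_μ` it is
`H ∘ ε`. -/
def pullbackHamiltonian (ε : CotBundle E Q → CotBundle E Q) : CotBundle E Q → ℝ := S.H ∘ ε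

/-- On `M ∩ J⁻¹(μ)`, where `ε̄_μ` is defined, `pullbackHamiltonian` is `h_μ ∘ ε̄_μ`. -/
theorem pullbackHamiltonian_eq {μ : EG →L[ℝ] ℝ} (ε : CotBundle E Q → CotBundle E Q)
    (hε : ∀ z ∈ S.M ∩ S.J ⁻¹' {μ}, ε z ∈ S.M ∩ S.J ⁻¹' {μ})
    (z : ↥(S.M ∩ S.J ⁻¹' {μ})) :
    S.reducedHamiltonian μ (S.epsBar ε hε z) = S.pullbackHamiltonian ε z := rfl

/-- The tangent map `Tε̄_μ = Tπ_μ · Tε`, on the vectors `v` at points of `M ∩ J⁻¹(μ)` for which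
`Tε · v` is tangent to `J⁻¹(μ)`. -/
def dEpsBar {μ : EG →L[ℝ] ℝ} (EP : Type*) [NormedAddCommGroup EP] [NormedSpace ℝ EP]
    [ChartedSpace EP (S.Level μ)] (EN : Type*) [NormedAddCommGroup EN] [NormedSpace ℝ EN]
    [ChartedSpace EN (S.Reduced μ)] (ε : CotBundle E Q → CotBundle E Q)
    (hε : ∀ z ∈ S.M ∩ S.J ⁻¹' {μ}, ε z ∈ S.M ∩ S.J ⁻¹' {μ})
    (z : ↥(S.M ∩ S.J ⁻¹' {μ})) (v : TangentSpace (IT E) z.1) :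
    TangentSpace 𝓘(ℝ, EN) (S.epsBar ε hε z) :=
  S.dRedAmbient EP EN ⟨ε z, (hε z z.2).2⟩ (mfderiv (IT E) (IT E) ε z.1 v)

/-- `γ̄_μ = π_μ ∘ γ : Q → (T^* Q)_μ`, for a one-form `γ` with image in `M ∩ J⁻¹(μ)`. Its values
lie in `M_μ`. -/
def gammaBar {μ : EG →L[ℝ] ℝ} (γ : ∀ q : Q, Cov E Q q)
    (hγ : ∀ q, toMap γ q ∈ S.M ∩ S.J ⁻¹' {μ}) (q : Q) : S.Reduced μ :=
  S.proj μ ⟨toMap γ q, (hγ q).2⟩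

/-- `λ̄_μ = π_μ ∘ λ` with `λ = γ ∘ π_Q`. Since `γ` has its image in `M ∩ J⁻¹(μ)`, it is defined on
the whole of `T^* Q`. -/
def lambdaBar {μ : EG →L[ℝ] ℝ} (γ : ∀ q : Q, Cov E Q q)
    (hγ : ∀ q, toMap γ q ∈ S.M ∩ S.J ⁻¹' {μ}) (z : CotBundle E Q) : S.Reduced μ :=
  S.proj μ ⟨toMap γ z.proj, (hγ z.proj).2⟩

end NonholonomicSystem

end System

end RCH

/-! The two equations are the same equation at each point, with the sides exchanged.

On one side, `λ̄_μ = γ̄_μ ∘ π_Q`, so the chain rule gives `Tλ̄_μ · X̃ · ε = Tγ̄_μ · X̃^ε`, base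
points included (`mfderiv_lambdaBar`).

On the other side, `τ_{𝓚_μ} · Tε̄_μ(X_{H ∘ ε}) = X_{𝓚_μ} · ε̄_μ` (`reducedTau_dEpsBar`). A
symplectic map satisfies `Tε · X_{H ∘ ε} = X_H · ε`. By Noether's theorem `X_H` lies in the kernel
of `TJ`, and at a regular value this kernel is the range of `T i_μ`, so `T π_μ` may be applied. The
result is the Hamiltonian vector of `h_μ` for `ω_μ` (`IsReduction.form_dRedAmbient`), and its
`𝓚_μ`-part is by definition `X_{𝓚_μ}`.

The remaining work supports these steps: local sections of submersions, curves in level sets, and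
the formula `ω = dq ∧ dp` in bundle charts. -/

namespace RCH

/-! ### Elements representing a functional, and the derivative of the model one-form -/

section LinearAlgebra

variable {V : Type*} [AddCommGroup V] [Module ℝ V]

theorem represent_spec {K : Submodule ℝ V} {B : V → V → ℝ} {α : V → ℝ}
    (h : ∃ k ∈ K, ∀ w ∈ K, B k w = α w) :
    represent K B α ∈ K ∧ ∀ w ∈ K, B (represent K B α) w = α w :=
  Classical.epsilon_spec (p := fun k => k ∈ K ∧ ∀ w ∈ K, B k w = α w) h

end LinearAlgebra

/-- The differentiated map is continuous linear in `y`, hence is its own derivative. With `B` the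
identity it is the one-form `p dq`. -/
theorem fderiv_comp_fst {E F : Type*} [NormedAddCommGroup E] [NormedSpace ℝ E]
    [NormedAddCommGroup F] [NormedSpace ℝ F] (B : F →L[ℝ] E →L[ℝ] ℝ) (a v w : E × F) :
    fderiv ℝ (fun y : E × F => (B y.2).comp (ContinuousLinearMap.fst ℝ E F)) a v w = B v.2 w.1 := by
  set T : E × F →L[ℝ] (E × F →L[ℝ] ℝ) :=
    (ContinuousLinearMap.precomp ℝ (ContinuousLinearMap.fst ℝ E F)).comp
      (B.comp (ContinuousLinearMap.snd ℝ E F))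
  have h : fderiv ℝ T a = T := T.fderiv
  exact congrArg (fun S : E × F →L[ℝ] (E × F →L[ℝ] ℝ) => S v w) h

theorem fderiv_snd_comp_fst {E : Type*} [NormedAddCommGroup E] [NormedSpace ℝ E]
    (a v w : E × (E →L[ℝ] ℝ)) :
    fderiv ℝ (fun y : E × (E →L[ℝ] ℝ) => y.2.comp (ContinuousLinearMap.fst ℝ E (E →L[ℝ] ℝ))) a v w =
      v.2 w.1 :=
  fderiv_comp_fst (ContinuousLinearMap.id ℝ (E →L[ℝ] ℝ)) a v w

/-! ### Submersions and curves in level sets -/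

section Manifolds

variable {E : Type*} [NormedAddCommGroup E] [NormedSpace ℝ E]
  {H : Type*} [TopologicalSpace H] {I : ModelWithCorners ℝ E H}
  {M : Type*} [TopologicalSpace M] [ChartedSpace H M]
  {E' : Type*} [NormedAddCommGroup E'] [NormedSpace ℝ E']
  {H' : Type*} [TopologicalSpace H'] {J : ModelWithCorners ℝ E' H'}
  {N : Type*} [TopologicalSpace N] [ChartedSpace H' N]
  {n : ℕ∞ω}

/-- A submersion has smooth local sections. -/
theorem _root_.Manifold.IsSubmersionAt.exists_local_section [I.Boundaryless] [J.Boundaryless]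
    [IsManifold I n M] [IsManifold J n N]
    {f : M → N} {x : M} (hf : IsSubmersionAt I J n f x) :
    ∃ σ : N → M, ContMDiffAt J I n σ (f x) ∧ σ (f x) = x ∧ ∀ᶠ y in 𝓝 (f x), f (σ y) = y := by
  set c := hf.domChart.extend I with hc
  set d := hf.codChart.extend J with hd
  have hxc : x ∈ c.source := by
    rw [hc, OpenPartialHomeomorph.extend_source]; exact hf.mem_domChart_source
  have hw : ∀ y ∈ c.target, d (f (c.symm y)) = (hf.equiv y).1 := fun y hy => hf.writtenInCharts hy
  -- In the charts `f` is a projection; the section freezes the complementary coordinate at its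
  -- value at `x`.
  set s : E' → E := fun y => hf.equiv.symm (y, (hf.equiv (c x)).2) with hs
  have hsx : s (d (f x)) = c x := by
    have h := hw (c x) (c.map_source hxc)
    rw [c.left_inv hxc] at h
    simp only [hs, h, Prod.mk.eta, ContinuousLinearEquiv.symm_apply_apply]
  have hs_smooth : ContMDiff 𝓘(ℝ, E') 𝓘(ℝ, E) n s := by
    rw [contMDiff_iff_contDiff]; fun_prop
  have hd_smooth : ContMDiffAt J 𝓘(ℝ, E') n d (f x) :=
    hf.codChart.contMDiffAt_extend hf.codChart_mem_maximalAtlas hf.mem_codChart_source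
  have hopen : IsOpen c.target := hf.domChart.isOpen_extend_target
  have hmem : c.target ∈ 𝓝 (c x) := hopen.mem_nhds (c.map_source hxc)
  have hc_smooth : ContMDiffAt 𝓘(ℝ, E) I n c.symm (s (d (f x))) := by
    rw [hsx]
    refine (contMDiffOn_extend_symm hf.domChart_mem_maximalAtlas).contMDiffAt ?_
    rwa [I.image_eq, ← OpenPartialHomeomorph.extend_target]
  have hsd : ContMDiffAt J 𝓘(ℝ, E) n (fun y => s (d y)) (f x) :=
    hs_smooth.contMDiffAt.comp (f x) hd_smooth
  refine ⟨fun y => c.symm (s (d y)), hc_smooth.comp (f x) hsd, ?_, ?_⟩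
  · show c.symm (s (d (f x))) = x
    rw [hsx, c.left_inv hxc]
  · have h1 : ∀ᶠ y in 𝓝 (f x), s (d y) ∈ c.target := by
      refine hsd.continuousAt.preimage_mem_nhds ?_
      rw [hsx]; exact hmem
    have hcont : ContinuousAt (fun y => f (c.symm (s (d y)))) (f x) := by
      have h2 : ContinuousAt f (c.symm (s (d (f x)))) := by
        rw [hsx, c.left_inv hxc]; exact hf.contMDiffAt.continuousAt
      exact ContinuousAt.comp (g := f) h2 (hc_smooth.comp (f x) hsd).continuousAt
    have hdn : d.source ∈ 𝓝 (f x) := by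
      rw [hd, OpenPartialHomeomorph.extend_source]
      exact hf.codChart.open_source.mem_nhds hf.mem_codChart_source
    have h3 : ∀ᶠ y in 𝓝 (f x), f (c.symm (s (d y))) ∈ d.source := by
      refine hcont.preimage_mem_nhds ?_
      simp only [hsx, c.left_inv hxc]; exact hdn
    filter_upwards [h1, h3, hdn] with y hy1 hy3 hy
    -- The codomain chart is injective only on its source, so both points had to be kept inside it,
    -- for `y` near `f x`.
    refine d.injOn hy3 hy ?_
    rw [hw _ hy1]
    simp [hs]

/-- Near `f x` one has `h = (h ∘ f) ∘ σ` for a local section `σ`. This lets differentiability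
descend to a quotient. -/
theorem _root_.Manifold.IsSubmersionAt.mdifferentiableAt_of_comp
    [I.Boundaryless] [J.Boundaryless] [IsManifold I n M] [IsManifold J n N]
    {F : Type*} [NormedAddCommGroup F] [NormedSpace ℝ F]
    {f : M → N} {x : M} (hf : IsSubmersionAt I J n f x) (hn : n ≠ 0) {h : N → F}
    (hh : MDifferentiableAt I 𝓘(ℝ, F) (fun y => h (f y)) x) :
    MDifferentiableAt J 𝓘(ℝ, F) h (f x) := by
  obtain ⟨σ, hσ, hσx, hfσ⟩ := hf.exists_local_section
  have h1 : MDifferentiableAt J 𝓘(ℝ, F) (fun y => h (f (σ y))) (f x) := by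
    refine MDifferentiableAt.comp (g := fun y => h (f y)) (f x) ?_ (hσ.mdifferentiableAt hn)
    rw [hσx]; exact hh
  refine h1.congr_of_eventuallyEq ?_
  filter_upwards [hfσ] with y hy
  rw [hy]

/-- Differentiating `f ∘ σ = id` makes the derivative of a local section a right inverse. -/
theorem _root_.Manifold.IsSubmersionAt.mfderiv_surjective
    [I.Boundaryless] [J.Boundaryless] [IsManifold I n M] [IsManifold J n N]
    {f : M → N} {x : M} (hf : IsSubmersionAt I J n f x) (hn : n ≠ 0) :
    Function.Surjective (mfderiv I J f x) := by
  obtain ⟨σ, hσ, hσx, hfσ⟩ := hf.exists_local_section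
  intro v
  have h1 : HasMFDerivAt J J (fun y => f (σ y)) (f x)
      ((mfderiv I J f (σ (f x))).comp (mfderiv J I σ (f x))) := by
    refine HasMFDerivAt.comp (f x) ?_ (hσ.mdifferentiableAt hn).hasMFDerivAt
    rw [hσx]; exact (hf.contMDiffAt.mdifferentiableAt hn).hasMFDerivAt
  have h2 : HasMFDerivAt J J (fun y => f (σ y)) (f x) (ContinuousLinearMap.id ℝ _) :=
    (hasMFDerivAt_id (f x)).congr_of_eventuallyEq hfσ
  have h3 := hasMFDerivAt_unique h1 h2
  have h4 := congrArg (fun T => T v) h3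
  rw [hσx] at h4
  exact ⟨_, h4⟩

/-- A vector in the kernel of the surjective derivative of a `C^n` map to a finite-dimensional
space is the velocity of a `C^n` curve in the level set. -/
theorem exists_curve_in_level_of_contDiffAt [CompleteSpace E]
    {F : Type*} [NormedAddCommGroup F] [NormedSpace ℝ F] [FiniteDimensional ℝ F]
    {g : E → F} {a : E} (hg : ContDiffAt ℝ n g a) (hn : n ≠ 0)
    (hsurj : Function.Surjective (fderiv ℝ g a)) {v : E} (hv : fderiv ℝ g a v = 0) :
    ∃ c : ℝ → E, ContDiffAt ℝ n c 0 ∧ c 0 = a ∧ (∀ᶠ t in 𝓝 0, g (c t) = g a) ∧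
      HasDerivAt c v 0 := by
  have := FiniteDimensional.complete ℝ F
  have hf : HasStrictFDerivAt g (fderiv ℝ g a) a := hg.hasStrictFDerivAt hn
  have hf' : (fderiv ℝ g a).range = ⊤ := LinearMap.range_eq_top.2 hsurj
  have hker := (fderiv ℝ g a).ker_closedComplemented_of_finiteDimensional_range
  -- The implicit function parametrizes the level set by the kernel of the derivative; the curve is
  -- the image of the line `t • v` in that kernel.
  set ψ := HasStrictFDerivAt.implicitFunctionDataOfComplemented g _ hf hf' hker with hψ
  set k : (fderiv ℝ g a).ker := ⟨v, hv⟩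
  have hpt : ψ.prodFun ψ.pt = (g a, 0) := by simp [hψ]
  have hψ_smooth : ContDiffAt ℝ n ψ.implicitFunction.uncurry (g a, (0 : ℝ) • k) := by
    rw [zero_smul, ← hpt]
    refine ψ.contDiffAt_implicitFunction hg ?_ hn
    exact ContDiffAt.comp (g := ψ.rightDeriv) (f := fun x => x - a) a
      (ContinuousLinearMap.contDiff _).contDiffAt
      (contDiffAt_id.sub contDiffAt_const)
  have hline : ContDiffAt ℝ n (fun t : ℝ => ((g a, t • k) : F × (fderiv ℝ g a).ker)) 0 := by
    fun_prop
  refine ⟨fun t => hf.implicitFunctionOfComplemented g _ hf' hker (g a) (t • k),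
    ContDiffAt.comp (g := ψ.implicitFunction.uncurry) (0 : ℝ) hψ_smooth hline, ?_, ?_, ?_⟩
  · simp
  · have h := hf.map_implicitFunctionOfComplemented_eq hf' hker
    have ht : Filter.Tendsto (fun t : ℝ => ((g a, t • k) : F × (fderiv ℝ g a).ker)) (𝓝 0)
        (𝓝 (g a, 0)) := by
      have := hline.continuousAt.tendsto
      simpa using this
    exact ht.eventually h
  · have h1 : HasDerivAt (fun t : ℝ => t • k) k 0 := by
      simpa using (hasDerivAt_id (0 : ℝ)).smul_const k
    -- At the base point the derivative of this parametrization is the inclusion of the kernel, so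
    -- the velocity is `v` itself.
    have h2 := hf.to_implicitFunctionOfComplemented hf' hker
    have h3 : HasFDerivAt (hf.implicitFunctionOfComplemented g _ hf' hker (g a))
        (fderiv ℝ g a).ker.subtypeL ((0 : ℝ) • k) := by
      rw [zero_smul]; exact h2.hasFDerivAt
    exact h3.comp_hasDerivAt (0 : ℝ) h1

/-- A tangent vector in the kernel of the surjective derivative of a `C^n` map to a
finite-dimensional space is the velocity of a `C^n` curve in the level set. -/
theorem exists_curve_in_level [CompleteSpace E] [I.Boundaryless] [IsManifold I n M]
    {F : Type*} [NormedAddCommGroup F] [NormedSpace ℝ F] [FiniteDimensional ℝ F]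
    {f : M → F} {x : M} (hf : ContMDiffAt I 𝓘(ℝ, F) n f x) (hn : n ≠ 0)
    (hsurj : Function.Surjective (mfderiv I 𝓘(ℝ, F) f x)) {v : TangentSpace I x}
    (hv : mfderiv I 𝓘(ℝ, F) f x v = 0) :
    ∃ c : ℝ → M, ContMDiffAt 𝓘(ℝ, ℝ) I n c 0 ∧ (∀ᶠ t in 𝓝 0, f (c t) = f x) ∧ c 0 = x ∧
      (mfderiv 𝓘(ℝ, ℝ) I c 0 (1 : ℝ) : E) = v := by
  have hM : IsManifold I 1 M := IsManifold.of_le (n := n) (ENat.one_le_iff_ne_zero_withTop.2 hn)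
  set φ := extChartAt I x with hφ
  have hsymm : ContMDiffAt 𝓘(ℝ, E) I n φ.symm (φ x) :=
    (contMDiffOn_extChartAt_symm x).contMDiffAt (extChartAt_target_mem_nhds x)
  have hx : φ.symm (φ x) = x := extChartAt_to_inv x
  have hg : ContDiffAt ℝ n (fun y => f (φ.symm y)) (φ x) := by
    rw [← contMDiffAt_iff_contDiffAt]
    refine ContMDiffAt.comp (g := f) (φ x) ?_ hsymm
    rw [hx]; exact hf
  have hd : (fderiv ℝ (fun y => f (φ.symm y)) (φ x) : E →L[ℝ] F) = mfderiv I 𝓘(ℝ, F) f x := by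
    rw [(hf.mdifferentiableAt hn).mfderiv, I.range_eq_univ, fderivWithin_univ]
    rfl
  obtain ⟨c, hc, hc0, hlev, hder⟩ := exists_curve_in_level_of_contDiffAt hg hn
    (v := v) (by rw [hd]; exact hsurj) (by rw [hd]; exact hv)
  have hsymm' : ContMDiffAt 𝓘(ℝ, E) I n φ.symm (c 0) := by rw [hc0]; exact hsymm
  have hcomp : ContMDiffAt 𝓘(ℝ, ℝ) I n (fun t => φ.symm (c t)) 0 :=
    hsymm'.comp (0 : ℝ) hc.contMDiffAt
  refine ⟨fun t => φ.symm (c t), hcomp, ?_, ?_, ?_⟩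
  · filter_upwards [hlev] with t ht
    rw [ht, hx]
  · simp only [hc0, hx]
  · have h1 : HasMFDerivAt 𝓘(ℝ, ℝ) I (fun t => φ.symm (c t)) 0 _ :=
      HasMFDerivAt.comp (0 : ℝ) (hsymm'.mdifferentiableAt hn).hasMFDerivAt
        hder.hasFDerivAt.hasMFDerivAt
    -- Tangent vectors at `x` are read in the preferred chart at `x`, so its inverse has identity
    -- derivative at the centre.
    have h2 : (mfderiv 𝓘(ℝ, E) I φ.symm (c 0) : E →L[ℝ] E) = ContinuousLinearMap.id ℝ E := by
      rw [hc0]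
      have := mfderivWithin_range_extChartAt_symm (I := I) (x := x)
      rwa [I.range_eq_univ, mfderivWithin_univ] at this
    rw [h1.mfderiv]
    show (mfderiv 𝓘(ℝ, E) I φ.symm (c 0) : E →L[ℝ] E) ((1 : ℝ) • v) = v
    rw [h2, one_smul]; rfl

end Manifolds

/-! ### The canonical forms in bundle charts -/

section Cotangent

variable {E : Type*} [NormedAddCommGroup E] [NormedSpace ℝ E]
  {Q : Type*} [TopologicalSpace Q] [ChartedSpace E Q]

theorem cotLift_one {G : Type*} [Group G] [MulAction G Q] (z : CotBundle E Q) :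
    cotLift (1 : G) z = z := by
  -- The fibre type depends on the base point `1 • q`; generalizing the action map to `φ` allows
  -- substitution of the identity.
  have h (φ : Q → Q) (hφ : φ = id) : (⟨φ z.proj,
      z.2.comp (mfderiv 𝓘(ℝ, E) 𝓘(ℝ, E) φ z.proj).inverse⟩ : CotBundle E Q) = z := by
    subst hφ
    rw [mfderiv_id, ContinuousLinearMap.inverse_id]
    rfl
  exact h (fun y => (1 : G) • y) (funext fun y => one_smul G y)

section

variable [IsManifold 𝓘(ℝ, E) 1 Q]

theorem extChartAt_cotBundle_apply (z w : CotBundle E Q) :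
    extChartAt (IT E) z w = (extChartAt 𝓘(ℝ, E) z.proj w.proj,
      (w.2 : E →L[ℝ] ℝ).comp
        ((trivializationAt E (TangentSpace 𝓘(ℝ, E)) z.proj).symmL ℝ w.proj)) := by
  have h := hom_chart (𝕜 := ℝ) (F₁ := E) (E₁ := (TangentSpace 𝓘(ℝ, E) : Q → Type _)) (F₂ := ℝ)
    (E₂ := fun _ : Q => ℝ) (HB := E) z w
  have h' : extChartAt (IT E) z w = chartAt (ModelProd E (E →L[ℝ] ℝ)) z w := rfl
  rw [h', h]
  refine Prod.ext rfl ?_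
  dsimp only [ContinuousLinearMap.inCoordinates]
  have ht : (trivializationAt ℝ (fun _ : Q => ℝ) z.proj).continuousLinearMapAt ℝ w.proj =
      ContinuousLinearMap.id ℝ ℝ := Bundle.Trivial.continuousLinearMapAt_trivialization ..
  rw [ht]
  rfl

theorem mem_extChartAt_cotBundle_source {z w : CotBundle E Q} :
    w ∈ (extChartAt (IT E) z).source ↔ w.proj ∈ (chartAt E z.proj).source := by
  rw [extChartAt_source, FiberBundle.chartedSpace_chartAt]
  simp only [mfld_simps]
  constructor
  · exact fun h => h.1.1
  · intro h
    refine ⟨⟨h, trivial⟩, h⟩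

end

variable [IsManifold 𝓘(ℝ, E) ∞ Q]

theorem proj_extChartAt_cotBundle_symm (z : CotBundle E Q) {y : E × (E →L[ℝ] ℝ)}
    (hy : y ∈ (extChartAt (IT E) z).target) :
    ((extChartAt (IT E) z).symm y).proj = (extChartAt 𝓘(ℝ, E) z.proj).symm y.1 := by
  have h1 := (extChartAt (IT E) z).right_inv hy
  rw [extChartAt_cotBundle_apply] at h1
  have h2 := mem_extChartAt_cotBundle_source.1 ((extChartAt (IT E) z).map_target hy)
  rw [← congrArg Prod.fst h1]
  exact ((extChartAt 𝓘(ℝ, E) z.proj).left_inv (by rwa [extChartAt_source])).symm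

/-- The representative of the canonical one-form in the preferred chart at `z`. -/
def canonicalOneFormInChart (z : CotBundle E Q) (y : E × (E →L[ℝ] ℝ)) :
    E × (E →L[ℝ] ℝ) →L[ℝ] ℝ :=
  (canonicalOneForm ((extChartAt (IT E) z).symm y)).comp
    (mfderiv 𝓘(ℝ, E × (E →L[ℝ] ℝ)) (IT E) (extChartAt (IT E) z).symm y)

/-- In the bundle chart with coordinates `(q, p)`, the canonical one-form is `p dq`. -/
theorem canonicalOneFormInChart_eq (z : CotBundle E Q)
    {y : E × (E →L[ℝ] ℝ)} (hy : y ∈ (extChartAt (IT E) z).target) :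
    canonicalOneFormInChart z y = y.2.comp (ContinuousLinearMap.fst ℝ E (E →L[ℝ] ℝ)) := by
  set φ := extChartAt (IT E) z with hφ
  set w := φ.symm y with hw
  have hM : IsManifold 𝓘(ℝ, E) 1 Q := IsManifold.of_le (n := ∞) (by simp)
  have hproj : MDifferentiableAt (IT E) 𝓘(ℝ, E) (fun x : CotBundle E Q => x.proj) w :=
    (contMDiffAt_proj (n := 1) (IB := 𝓘(ℝ, E)) (Cov E Q)).mdifferentiableAt one_ne_zero
  have hsymm : MDifferentiableAt 𝓘(ℝ, E × (E →L[ℝ] ℝ)) (IT E) φ.symm y := by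
    exact ((contMDiffOn_extChartAt_symm (n := 1) z).contMDiffAt
      ((isOpen_extChartAt_target z).mem_nhds hy)).mdifferentiableAt one_ne_zero
  have hwmem : w.proj ∈ (chartAt E z.proj).source :=
    mem_extChartAt_cotBundle_source.1 (φ.map_target hy)
  have hy' : extChartAt 𝓘(ℝ, E) z.proj w.proj = y.1 ∧ (w.2 : E →L[ℝ] ℝ).comp
        ((trivializationAt E (TangentSpace 𝓘(ℝ, E)) z.proj).symmL ℝ w.proj) = y.2 := by
    have h1 := φ.right_inv hy
    rw [hφ, extChartAt_cotBundle_apply] at h1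
    exact ⟨congrArg Prod.fst h1, congrArg Prod.snd h1⟩
  have h1 := HasMFDerivAt.comp (g := fun x : CotBundle E Q => x.proj) y hproj.hasMFDerivAt
    hsymm.hasMFDerivAt
  have hy1 : y.1 ∈ (extChartAt 𝓘(ℝ, E) z.proj).target := by
    rw [← hy'.1]
    exact (extChartAt 𝓘(ℝ, E) z.proj).map_source (by rwa [extChartAt_source])
  have hQ : MDifferentiableAt 𝓘(ℝ, E) 𝓘(ℝ, E) (extChartAt 𝓘(ℝ, E) z.proj).symm y.1 :=
    ((contMDiffOn_extChartAt_symm (n := 1) z.proj).contMDiffAt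
      ((isOpen_extChartAt_target z.proj).mem_nhds hy1)).mdifferentiableAt one_ne_zero
  have h2 : HasMFDerivAt 𝓘(ℝ, E × (E →L[ℝ] ℝ)) 𝓘(ℝ, E)
      (fun x : E × (E →L[ℝ] ℝ) => (extChartAt 𝓘(ℝ, E) z.proj).symm x.1) y
      ((mfderiv 𝓘(ℝ, E) 𝓘(ℝ, E) (extChartAt 𝓘(ℝ, E) z.proj).symm y.1 : E →L[ℝ] E).comp
        (ContinuousLinearMap.fst ℝ E (E →L[ℝ] ℝ))) :=
    HasMFDerivAt.comp (g := (extChartAt 𝓘(ℝ, E) z.proj).symm) y hQ.hasMFDerivAt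
      (ContinuousLinearMap.fst ℝ E (E →L[ℝ] ℝ)).hasFDerivAt.hasMFDerivAt
  have h3 : (fun x => (φ.symm x).proj) =ᶠ[𝓝 y]
      fun x : E × (E →L[ℝ] ℝ) => (extChartAt 𝓘(ℝ, E) z.proj).symm x.1 := by
    filter_upwards [(isOpen_extChartAt_target (I := IT E) z).mem_nhds hy] with x hx
    exact proj_extChartAt_cotBundle_symm z hx
  -- Both expressions differentiate `π_Q` after the inverse bundle chart, which is the inverse chart
  -- of `Q` on the first coordinate.
  have h4 := hasMFDerivAt_unique h1 (h2.congr_of_eventuallyEq h3)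
  -- The map that defines the fibre coordinate `p` is this same derivative of the inverse chart of
  -- `Q`, so the two cancel to leave `p dq`.
  have h5 : (trivializationAt E (TangentSpace 𝓘(ℝ, E)) z.proj).symmL ℝ w.proj =
      (mfderiv 𝓘(ℝ, E) 𝓘(ℝ, E) (extChartAt 𝓘(ℝ, E) z.proj).symm y.1 : E →L[ℝ] E) := by
    have := TangentBundle.symmL_trivializationAt (I := 𝓘(ℝ, E)) hwmem
    rw [ModelWithCorners.range_eq_univ, mfderivWithin_univ, hy'.1] at this
    exact this
  rw [h5] at hy'
  rw [← hy'.2]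
  exact congrArg (fun L : E × (E →L[ℝ] ℝ) →L[ℝ] E => (w.2 : E →L[ℝ] ℝ).comp L) h4

/-- The one-form is `p dq` on a whole neighbourhood in the chart, so its derivative there is that of
the model form. -/
theorem canonicalForm_apply (z : CotBundle E Q) (v w : E × (E →L[ℝ] ℝ)) :
    canonicalForm z v w = w.2 v.1 - v.2 w.1 := by
  have h1 : canonicalOneFormInChart z =ᶠ[𝓝 (extChartAt (IT E) z z)]
      fun y => y.2.comp (ContinuousLinearMap.fst ℝ E (E →L[ℝ] ℝ)) := by
    filter_upwards [extChartAt_target_mem_nhds (I := IT E) z] with y hy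
    exact canonicalOneFormInChart_eq z hy
  have h2 : canonicalForm z v w =
      -(fderiv ℝ (canonicalOneFormInChart z) (extChartAt (IT E) z z) v w -
        fderiv ℝ (canonicalOneFormInChart z) (extChartAt (IT E) z z) w v) := rfl
  rw [h2, h1.fderiv_eq, fderiv_snd_comp_fst, fderiv_snd_comp_fst, neg_sub]

theorem canonicalForm_antisymm (z : CotBundle E Q) (v w : TangentSpace (IT E) z) :
    canonicalForm z v w = -canonicalForm z w v := by
  rw [canonicalForm_apply z v w, canonicalForm_apply z w v, neg_sub]

/-- Pairing with `(0, α)` kills the base component, as covectors separate points; pairing with `(x,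
0)` kills the fibre component. -/
theorem canonicalForm_nondegenerate (z : CotBundle E Q) (v : E × (E →L[ℝ] ℝ))
    (h : ∀ w : E × (E →L[ℝ] ℝ), canonicalForm z v w = 0) : v = 0 := by
  have h1 : v.1 = 0 := by
    refine SeparatingDual.eq_zero_of_forall_dual_eq_zero (R := ℝ) fun α => ?_
    have := h (0, α)
    rw [canonicalForm_apply] at this
    simpa using this
  have h2 : v.2 = 0 := by
    ext x
    have := h (x, 0)
    rw [canonicalForm_apply] at this
    simpa using this
  exact Prod.ext h1 h2

theorem canonicalForm_ext (z : CotBundle E Q) {v v' : E × (E →L[ℝ] ℝ)}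
    (h : ∀ w : E × (E →L[ℝ] ℝ), canonicalForm z v w = canonicalForm z v' w) : v = v' := by
  rw [← sub_eq_zero]
  refine canonicalForm_nondegenerate z _ fun w => ?_
  have hw := h w
  rw [canonicalForm_apply, canonicalForm_apply] at hw
  rw [canonicalForm_apply]
  simp only [Prod.fst_sub, Prod.snd_sub, map_sub, sub_apply]
  linarith

/-! ### Hamiltonian vector fields, symplectic maps and Noether's theorem -/

section FiniteDimensional

variable [FiniteDimensional ℝ E]

/-- Non-degeneracy is injectivity of `v ↦ ω(v, ·)`, and equal finite dimensions make it onto. Hence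
the choice in `hamiltonianVectorField` is a genuine solution. -/
theorem exists_canonicalForm_eq (z : CotBundle E Q) (α : TangentSpace (IT E) z →L[ℝ] ℝ) :
    ∃ v, ∀ w, canonicalForm z v w = α w := by
  let T : (E × (E →L[ℝ] ℝ)) →ₗ[ℝ] Module.Dual ℝ (E × (E →L[ℝ] ℝ)) :=
    LinearMap.mk₂ ℝ (fun v w : E × (E →L[ℝ] ℝ) => w.2 v.1 - v.2 w.1)
      (fun v v' w => by simp; ring) (fun c v w => by simp; ring)
      (fun v w w' => by simp; ring) (fun c v w => by simp; ring)
  have hT (v w : E × (E →L[ℝ] ℝ)) : canonicalForm z v w = T v w := canonicalForm_apply z v w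
  have hinj : Function.Injective T := by
    rw [injective_iff_map_eq_zero]
    intro v hv
    exact canonicalForm_nondegenerate z v fun w => (hT v w).trans (LinearMap.congr_fun hv w)
  have hsurj : Function.Surjective T :=
    (LinearMap.injective_iff_surjective_of_finrank_eq_finrank
      Subspace.dual_finrank_eq.symm).1 hinj
  obtain ⟨v, hv⟩ := hsurj (α : E × (E →L[ℝ] ℝ) →L[ℝ] ℝ).toLinearMap
  exact ⟨v, fun w => (hT v w).trans (LinearMap.congr_fun hv w)⟩

theorem canonicalForm_hamiltonianVectorField (f : CotBundle E Q → ℝ) (z : CotBundle E Q)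
    (w : TangentSpace (IT E) z) :
    canonicalForm z (hamiltonianVectorField f z) w = dFun f z w := by
  obtain ⟨v, hv⟩ := exists_canonicalForm_eq z (dFun f z)
  exact (represent_spec (K := ⊤) (B := fun v w => canonicalForm z v w) (α := dFun f z)
    ⟨v, Submodule.mem_top, fun w _ => hv w⟩).2 w Submodule.mem_top

/-- A symplectic map carries the Hamiltonian vector field of `f ∘ ε` to that of `f`. -/
theorem IsSymplecticMap.mfderiv_hamiltonianVectorField {ε : CotBundle E Q → CotBundle E Q}
    (hε : IsSymplecticMap ε) {f : CotBundle E Q → ℝ} {z : CotBundle E Q}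
    (hf : MDifferentiableAt (IT E) 𝓘(ℝ, ℝ) f (ε z)) :
    mfderiv (IT E) (IT E) ε z (hamiltonianVectorField (f ∘ ε) z) =
      hamiltonianVectorField f (ε z) := by
  set D : E × (E →L[ℝ] ℝ) →L[ℝ] E × (E →L[ℝ] ℝ) := mfderiv (IT E) (IT E) ε z
  -- A kernel vector of `Tε` would be `ω`-orthogonal to everything. Bijectivity then allows every
  -- test vector below to be written as `Tε w'`, where `ε^* ω = ω` applies.
  have hinj : Function.Injective D.toLinearMap := by
    rw [injective_iff_map_eq_zero]
    intro v hv
    refine canonicalForm_nondegenerate z v fun w => ?_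
    have hv' : mfderiv (IT E) (IT E) ε z v = 0 := hv
    rw [← hε.2 z v w, hv']
    exact (canonicalForm_apply (ε z) 0 _).trans (by simp)
  have hsurj : Function.Surjective D.toLinearMap := LinearMap.injective_iff_surjective.1 hinj
  have hdf : dFun (f ∘ ε) z = (dFun f (ε z)).comp (mfderiv (IT E) (IT E) ε z) :=
    mfderiv_comp z hf (hε.1.mdifferentiable (by simp) z)
  refine canonicalForm_ext (ε z) fun w => ?_
  obtain ⟨w', rfl⟩ := hsurj w
  refine (hε.2 z _ w').trans ((canonicalForm_hamiltonianVectorField _ z w').trans ?_)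
  rw [hdf]
  exact (canonicalForm_hamiltonianVectorField f (ε z) (mfderiv (IT E) (IT E) ε z w')).symm

/-- Noether's theorem: the Hamiltonian vector field of an invariant function is tangent to the
level sets of the momentum map. -/
theorem IsMomentumMap.mfderiv_hamiltonianVectorField
    {EG : Type*} [NormedAddCommGroup EG] [NormedSpace ℝ EG]
    {G : Type*} [TopologicalSpace G] [ChartedSpace EG G] [Group G] [MulAction G Q]
    {J : CotBundle E Q → EG →L[ℝ] ℝ} (hJ : IsMomentumMap (G := G) EG J)
    {f : CotBundle E Q → ℝ} {z : CotBundle E Q} (hf : MDifferentiable (IT E) 𝓘(ℝ, ℝ) f)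
    (hinv : ∀ (g : G) (z : CotBundle E Q), f (cotLift g z) = f z) :
    mfderiv (IT E) 𝓘(ℝ, EG →L[ℝ] ℝ) J z (hamiltonianVectorField f z) = 0 := by
  -- `f` is constant along the orbit map `g ↦ g z`.
  have hgen (ξ : GroupLieAlgebra 𝓘(ℝ, EG) G) : dFun f z (generator EG ξ z) = 0 := by
    by_cases hd : MDifferentiableAt 𝓘(ℝ, EG) (IT E) (fun g : G => cotLift g z) 1
    · have h1 : (fun g : G => f (cotLift g z)) = fun _ => f z := funext fun g => hinv g z
      have hfz (z' : CotBundle E Q) (hz' : z' = z) : HasMFDerivAt (IT E) 𝓘(ℝ, ℝ) f z'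
          (mfderiv (IT E) 𝓘(ℝ, ℝ) f z : E × (E →L[ℝ] ℝ) →L[ℝ] ℝ) := by
        subst hz'; exact (hf _).hasMFDerivAt
      have h2 := HasMFDerivAt.comp (g := f) (1 : G) (hfz _ (cotLift_one z)) hd.hasMFDerivAt
      have h3 : HasMFDerivAt 𝓘(ℝ, EG) 𝓘(ℝ, ℝ) (fun g : G => f (cotLift g z)) 1 0 := by
        rw [h1]; exact hasMFDerivAt_const _ _
      have h4 := hasMFDerivAt_unique h2 h3
      exact congrArg (fun L : EG →L[ℝ] ℝ => L ξ) h4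
    -- Where the orbit map is not differentiable, `mfderiv` takes the default value zero, and so
    -- does the generator.
    · have h1 : generator EG ξ z = 0 := by
        unfold generator
        rw [mfderiv_zero_of_not_mdifferentiableAt hd]
        rfl
      rw [h1]
      exact ContinuousLinearMap.map_zero _
  refine ContinuousLinearMap.ext fun ξ => ?_
  have h1 : HasMFDerivAt (IT E) 𝓘(ℝ, ℝ) (fun y => J y ξ) z
      ((ContinuousLinearMap.apply ℝ ℝ ξ).comp
        (mfderiv (IT E) 𝓘(ℝ, EG →L[ℝ] ℝ) J z : E × (E →L[ℝ] ℝ) →L[ℝ] EG →L[ℝ] ℝ)) :=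
    HasMFDerivAt.comp (g := fun L : EG →L[ℝ] ℝ => L ξ) z
      (ContinuousLinearMap.apply ℝ ℝ ξ).hasFDerivAt.hasMFDerivAt
      (hJ.1.mdifferentiable (by simp) z).hasMFDerivAt
  -- `d⟨J, ξ⟩(X_f) = ω(ξ_{T^*Q}, X_f) = -df(ξ_{T^*Q}) = 0`.
  have h2 := hJ.2.1 ξ z (hamiltonianVectorField f z)
  rw [canonicalForm_antisymm, canonicalForm_hamiltonianVectorField] at h2
  replace h2 := h2.trans (neg_eq_zero.2 (hgen ξ))
  rw [dFun, h1.mfderiv] at h2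
  exact h2

end FiniteDimensional

end Cotangent

/-! ### Passage to the level set and to the reduced space -/

namespace NonholonomicSystem

variable {E : Type*} [NormedAddCommGroup E] [NormedSpace ℝ E]
  {Q : Type*} [TopologicalSpace Q] [ChartedSpace E Q] [IsManifold 𝓘(ℝ, E) ∞ Q]
  {EG : Type*} [NormedAddCommGroup EG] [NormedSpace ℝ EG]
  {G : Type*} [TopologicalSpace G] [ChartedSpace EG G] [Group G] [MulAction G Q]
  (S : NonholonomicSystem E Q EG G) {μ : EG →L[ℝ] ℝ}
  {EP : Type*} [NormedAddCommGroup EP] [NormedSpace ℝ EP]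
  [ChartedSpace EP (S.Level μ)]
  {EN : Type*} [NormedAddCommGroup EN] [NormedSpace ℝ EN]
  [ChartedSpace EN (S.Reduced μ)]

variable {S}

/-- At a regular value, `T i_μ` is onto the kernel of `T J`. -/
theorem exists_dIncl_eq [FiniteDimensional ℝ E] [FiniteDimensional ℝ EG]
    (hincl : IsSmoothEmbedding 𝓘(ℝ, EP) (IT E) ∞ (S.incl μ)) (z : S.Level μ)
    (hreg : Function.Surjective (mfderiv (IT E) 𝓘(ℝ, EG →L[ℝ] ℝ) S.J z.1))
    {v : TangentSpace (IT E) z.1} (hv : mfderiv (IT E) 𝓘(ℝ, EG →L[ℝ] ℝ) S.J z.1 v = 0) :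
    ∃ v', S.dIncl EP z v' = v := by
  obtain ⟨c, hc, hlev, hc0, hder⟩ := exists_curve_in_level (n := ∞)
    S.J_momentum.1.contMDiffAt (by simp) hreg hv
  classical
  -- The value `z` is a filler: only the germ at `0` matters, and there the curve stays in the level
  -- set.
  set c' : ℝ → S.Level μ := fun t => if h : S.J (c t) = μ then ⟨c t, h⟩ else z with hc'
  have hic : (fun t => S.incl μ (c' t)) =ᶠ[𝓝 0] c := by
    filter_upwards [hlev] with t ht
    have ht' : S.J (c t) = μ := ht.trans z.2
    simp [hc', ht', incl]
  have hc'0 : c' 0 = z := by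
    have h := hic.eq_of_nhds
    exact Subtype.ext (h.trans hc0)
  have hcomp : ContMDiffAt 𝓘(ℝ, ℝ) (IT E) ∞ (S.incl μ ∘ c') 0 := hc.congr_of_eventuallyEq hic
  -- A map into an embedded submanifold is smooth once its composite with the inclusion is.
  have hsmooth : ContMDiffAt 𝓘(ℝ, ℝ) 𝓘(ℝ, EP) ∞ c' 0 :=
    (ContMDiffAt.iff_comp_isImmersionAt (hincl.isImmersion.isImmersionAt _)).2
      ⟨hincl.isEmbedding.continuousAt_iff.2 hcomp.continuousAt, hcomp⟩
  have hi (p : S.Level μ) (hp : p = z) : HasMFDerivAt 𝓘(ℝ, EP) (IT E) (S.incl μ) p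
      (S.dIncl EP z : EP →L[ℝ] E × (E →L[ℝ] ℝ)) := by
    subst hp; exact (hincl.contMDiff.mdifferentiable (by simp) _).hasMFDerivAt
  have h1 := HasMFDerivAt.comp (g := S.incl μ) (0 : ℝ) (hi _ hc'0)
    (hsmooth.mdifferentiableAt (by simp)).hasMFDerivAt
  have h2 : HasMFDerivAt 𝓘(ℝ, ℝ) (IT E) (S.incl μ ∘ c') 0
      (mfderiv 𝓘(ℝ, ℝ) (IT E) c 0 : ℝ →L[ℝ] E × (E →L[ℝ] ℝ)) :=
    (hc.mdifferentiableAt (by simp)).hasMFDerivAt.congr_of_eventuallyEq hic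
  have h3 := hasMFDerivAt_unique h1 h2
  exact ⟨(mfderiv 𝓘(ℝ, ℝ) 𝓘(ℝ, EP) c' 0 : ℝ →L[ℝ] EP) 1,
    (congrArg (fun L : ℝ →L[ℝ] E × (E →L[ℝ] ℝ) => L 1) h3).trans hder⟩

/-- `dRedAmbient` chooses a preimage under `T i_μ`; for a vector in the range, the choice is a true
preimage. -/
theorem exists_dRedAmbient_eq {z : S.Level μ} {v : TangentSpace (IT E) z.1}
    (hv : ∃ v', S.dIncl EP z v' = v) :
    ∃ v', S.dIncl EP z v' = v ∧ S.dRedAmbient EP EN z v = S.dRed EP EN z v' :=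
  ⟨_, Classical.epsilon_spec hv, rfl⟩

variable {ωμ : ∀ p : S.Reduced μ,
  TangentSpace 𝓘(ℝ, EN) p →L[ℝ] TangentSpace 𝓘(ℝ, EN) p →L[ℝ] ℝ}

/-- `T π_μ` carries `X_H` along `J⁻¹(μ)` to the Hamiltonian vector field of `h_μ`. -/
theorem IsReduction.form_dRedAmbient [FiniteDimensional ℝ E]
    [IsManifold 𝓘(ℝ, EP) ∞ (S.Level μ)] [IsManifold 𝓘(ℝ, EN) ∞ (S.Reduced μ)]
    (hred : S.IsReduction EP EN ωμ) {z : S.Level μ}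
    (hv : ∃ v', S.dIncl EP z v' = hamiltonianVectorField S.H z.1)
    (n : TangentSpace 𝓘(ℝ, EN) (S.proj μ z)) :
    ωμ (S.proj μ z) (S.dRedAmbient EP EN z (hamiltonianVectorField S.H z.1)) n =
      mfderiv 𝓘(ℝ, EN) 𝓘(ℝ, ℝ) (S.reducedHamiltonian μ) (S.proj μ z) n := by
  obtain ⟨v', hv', heq⟩ := exists_dRedAmbient_eq (EN := EN) hv
  -- As `T π_μ` is onto, `n` may be taken as the image of some `w`, to which `π_μ^* ω_μ = i_μ^* ω`
  -- applies.
  have hsub := hred.proj_submersion.isSubmersionAt z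
  obtain ⟨w, rfl⟩ := hsub.mfderiv_surjective (by simp) n
  have hH : MDifferentiableAt (IT E) 𝓘(ℝ, ℝ) S.H (S.incl μ z) :=
    S.H_smooth.mdifferentiable (by simp) _
  have h1 := HasMFDerivAt.comp (g := S.H) z hH.hasMFDerivAt
    (hred.incl_embedding.contMDiff.mdifferentiable (by simp) z).hasMFDerivAt
  -- `h_μ` is a bare quotient lift; its differentiability comes from that of `h_μ ∘ π_μ = H ∘ i_μ`,
  -- whose two derivatives are compared next.
  have hh : MDifferentiableAt 𝓘(ℝ, EN) 𝓘(ℝ, ℝ) (S.reducedHamiltonian μ) (S.proj μ z) :=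
    hsub.mdifferentiableAt_of_comp (by simp) h1.mdifferentiableAt
  have h2 := HasMFDerivAt.comp (g := S.reducedHamiltonian μ) z hh.hasMFDerivAt
    (hsub.contMDiffAt.mdifferentiableAt (by simp)).hasMFDerivAt
  have h3 := hasMFDerivAt_unique h1 h2
  rw [heq]
  refine (hred.pullback_form z v' w).trans ?_
  rw [hv', canonicalForm_hamiltonianVectorField]
  exact congrArg (fun L : EP →L[ℝ] ℝ => L w) h3

theorem mdifferentiable_gammaBar (hred : S.IsReduction EP EN ωμ) {γ : ∀ q : Q, Cov E Q q}
    (hγ_smooth : ContMDiff 𝓘(ℝ, E) (IT E) ∞ (toMap γ))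
    (hγ : ∀ q, toMap γ q ∈ S.M ∩ S.J ⁻¹' {μ}) :
    MDifferentiable 𝓘(ℝ, E) 𝓘(ℝ, EN) (S.gammaBar γ hγ) := by
  intro q
  have h1 : ContMDiffAt 𝓘(ℝ, E) 𝓘(ℝ, EP) ∞
      (fun q => (⟨toMap γ q, (hγ q).2⟩ : S.Level μ)) q :=
    (ContMDiffAt.iff_comp_isImmersionAt
      (hred.incl_embedding.isImmersion.isImmersionAt _)).2
      ⟨hred.incl_embedding.isEmbedding.continuousAt_iff.2 hγ_smooth.continuous.continuousAt,
        hγ_smooth q⟩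
  exact ((hred.proj_submersion.contMDiff _).comp q h1).mdifferentiableAt (by simp)

theorem mfderiv_lambdaBar (hred : S.IsReduction EP EN ωμ) {γ : ∀ q : Q, Cov E Q q}
    (hγ_smooth : ContMDiff 𝓘(ℝ, E) (IT E) ∞ (toMap γ))
    (hγ : ∀ q, toMap γ q ∈ S.M ∩ S.J ⁻¹' {μ}) (z : CotBundle E Q) :
    mfderiv (IT E) 𝓘(ℝ, EN) (S.lambdaBar γ hγ) z =
      (mfderiv 𝓘(ℝ, E) 𝓘(ℝ, EN) (S.gammaBar γ hγ) z.proj).comp (dProj z) :=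
  mfderiv_comp (g := S.gammaBar γ hγ) (f := fun y : CotBundle E Q => y.proj) z
    (mdifferentiable_gammaBar hred hγ_smooth hγ z.proj)
    ((contMDiffAt_proj (n := ∞) (IB := 𝓘(ℝ, E)) (Cov E Q)).mdifferentiableAt (by simp))

/-- The `𝓚_μ`-part of `Tε̄_μ(X_{H ∘ ε})` is the reduced dynamical vector field. -/
theorem reducedTau_dEpsBar [FiniteDimensional ℝ E] [FiniteDimensional ℝ EG]
    [IsManifold 𝓘(ℝ, EP) ∞ (S.Level μ)] [IsManifold 𝓘(ℝ, EN) ∞ (S.Reduced μ)]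
    {u : ∀ q : Q, Cov E Q q → Cov E Q q}
    (hS : S.IsPointReducible EP EN ωμ u) {ε : CotBundle E Q → CotBundle E Q}
    (hε_symplectic : IsSymplecticMap ε)
    (hε : ∀ z ∈ S.M ∩ S.J ⁻¹' {μ}, ε z ∈ S.M ∩ S.J ⁻¹' {μ})
    (z : ↥(S.M ∩ S.J ⁻¹' {μ})) :
    S.reducedTau EP EN ωμ (S.epsBar ε hε z)
        (S.dEpsBar EP EN ε hε z (hamiltonianVectorField (S.pullbackHamiltonian ε) z.1)) =
      S.reducedField EP EN ωμ (S.epsBar ε hε z) := by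
  have hH : MDifferentiable (IT E) 𝓘(ℝ, ℝ) S.H := S.H_smooth.mdifferentiable (by simp)
  set w : S.Level μ := ⟨ε z, (hε z z.2).2⟩
  have hv : ∃ v', S.dIncl EP w v' = hamiltonianVectorField S.H w.1 :=
    exists_dIncl_eq hS.reduction.incl_embedding w (hS.regular_value w.1 w.2)
      (S.J_momentum.mfderiv_hamiltonianVectorField hH S.H_invariant)
  have h1 : S.dEpsBar EP EN ε hε z (hamiltonianVectorField (S.pullbackHamiltonian ε) z.1) =
      S.dRedAmbient EP EN w (hamiltonianVectorField S.H w.1) :=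
    congrArg (S.dRedAmbient EP EN w) (hε_symplectic.mfderiv_hamiltonianVectorField (hH _))
  rw [h1]
  -- Both sides are the element of `𝓚_μ` chosen for a functional via `ω_μ`; once the functionals
  -- agree, so do the choices.
  exact congrArg (represent _ _) (funext fun n => hS.reduction.form_dRedAmbient hv n)

end NonholonomicSystem

end RCH

/-! ### The equivalence -/

theorem theorem5p4
    {E : Type*} [NormedAddCommGroup E] [NormedSpace ℝ E] [FiniteDimensional ℝ E]
    {Q : Type*} [TopologicalSpace Q] [T2Space Q] [SecondCountableTopology Q]
    [ChartedSpace E Q] [IsManifold 𝓘(ℝ, E) ∞ Q]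
    {EG : Type*} [NormedAddCommGroup EG] [NormedSpace ℝ EG] [FiniteDimensional ℝ EG]
    {G : Type*} [TopologicalSpace G] [ChartedSpace EG G] [Group G] [LieGroup 𝓘(ℝ, EG) ∞ G]
    [MulAction G Q]
    (S : RCH.NonholonomicSystem E Q EG G)
    (A : RCH.VerticalConnection E Q)
    (u : ∀ q : Q, RCH.Cov E Q q → RCH.Cov E Q q)
    (μ : EG →L[ℝ] ℝ)
    {EP : Type*} [NormedAddCommGroup EP] [NormedSpace ℝ EP] [FiniteDimensional ℝ EP]
    [ChartedSpace EP (S.Level μ)] [IsManifold 𝓘(ℝ, EP) ∞ (S.Level μ)]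
    {EN : Type*} [NormedAddCommGroup EN] [NormedSpace ℝ EN] [FiniteDimensional ℝ EN]
    [ChartedSpace EN (S.Reduced μ)] [IsManifold 𝓘(ℝ, EN) ∞ (S.Reduced μ)]
    (ωμ : ∀ p : S.Reduced μ, TangentSpace 𝓘(ℝ, EN) p →L[ℝ] TangentSpace 𝓘(ℝ, EN) p →L[ℝ] ℝ)
    (hS : S.IsPointReducible EP EN ωμ u)
    -- the one-form `γ`
    (γ : ∀ q : Q, RCH.Cov E Q q)
    (hγ_smooth : ContMDiff 𝓘(ℝ, E) (RCH.IT E) ∞ (RCH.toMap γ))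
    (hγ : ∀ q, RCH.toMap γ q ∈ S.M ∩ S.J ⁻¹' {μ})
    (hγ_invariant : ∀ g ∈ RCH.NonholonomicSystem.isotropy G μ, ∀ q : Q,
      RCH.toMap γ (g • q) = RCH.cotLift g (RCH.toMap γ q))
    (hγ_tangent : ∀ (q : Q) (v : TangentSpace 𝓘(ℝ, E) q),
      mfderiv 𝓘(ℝ, E) 𝓘(ℝ, EN) (S.gammaBar γ hγ) q v ∈ S.reducedK EP EN (S.gammaBar γ hγ q))
    -- the symplectic map `ε`
    (ε : RCH.CotBundle E Q → RCH.CotBundle E Q)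
    (hε_symplectic : RCH.IsSymplecticMap ε)
    (hε_invariant : ∀ g ∈ RCH.NonholonomicSystem.isotropy G μ, ∀ z : RCH.CotBundle E Q,
      ε (RCH.cotLift g z) = RCH.cotLift g (ε z))
    (hε : ∀ z ∈ S.M ∩ S.J ⁻¹' {μ}, ε z ∈ S.M ∩ S.J ⁻¹' {μ}) :
    -- the equation `τ_{𝓚_μ} · Tε̄_μ(X_{h_{𝓚_μ} ∘ ε̄_μ}) = Tλ̄_μ · X̃ · ε`
    (∀ z : ↥(S.M ∩ S.J ⁻¹' {μ}),
      (⟨S.epsBar ε hε z, S.reducedTau EP EN ωμ (S.epsBar ε hε z)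
          (S.dEpsBar EP EN ε hε z (RCH.hamiltonianVectorField (S.pullbackHamiltonian ε) z.1))⟩ :
        TangentBundle 𝓘(ℝ, EN) (S.Reduced μ)) =
      tangentMap (RCH.IT E) 𝓘(ℝ, EN) (S.lambdaBar γ hγ)
        ⟨ε z.1, S.dynamicalField A u (ε z.1)⟩) ↔
    -- the equation `Tγ̄_μ · X̃^ε = X_{𝓚_μ} · ε̄_μ` with `X̃^ε = Tπ_Q · X̃ · ε`
    (∀ z : ↥(S.M ∩ S.J ⁻¹' {μ}),
      tangentMap 𝓘(ℝ, E) 𝓘(ℝ, EN) (S.gammaBar γ hγ)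
        ⟨(ε z.1).proj, RCH.dProj (ε z.1) (S.dynamicalField A u (ε z.1))⟩ =
      (⟨S.epsBar ε hε z, S.reducedField EP EN ωμ (S.epsBar ε hε z)⟩ :
        TangentBundle 𝓘(ℝ, EN) (S.Reduced μ))) := by
  refine forall_congr' fun z => ?_
  rw [RCH.NonholonomicSystem.reducedTau_dEpsBar hS hε_symplectic hε z]
  -- The base points agree by definition, since `λ̄_μ` is `γ̄_μ` after projection to `Q`; only the
  -- vector part needs the chain rule.
  have h : tangentMap (RCH.IT E) 𝓘(ℝ, EN) (S.lambdaBar γ hγ)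
        ⟨ε z.1, S.dynamicalField A u (ε z.1)⟩ =
      tangentMap 𝓘(ℝ, E) 𝓘(ℝ, EN) (S.gammaBar γ hγ)
        ⟨(ε z.1).proj, RCH.dProj (ε z.1) (S.dynamicalField A u (ε z.1))⟩ := by
    unfold tangentMap
    rw [RCH.NonholonomicSystem.mfderiv_lambdaBar hS.reduction hγ_smooth hγ]
    rfl
  rw [h]
  exact eq_comm
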